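/- Let $X$ be a finite alphabet with at least two letters. An automaton $A=(S,X,\pi)$ consists of a finite set of states $S$ and a map $\pi:S\times X\to X\times S$; we write $s\xrightarrow{x|y}t$ if $\pi(s,x)=(y,t)$. Every state $s$ transforms finite and right-infinite words letter by letter: $s(x_1x_2\ldots)=y_1y_2\ldots$ if $s=s_1\xrightarrow{x_1|y_1}s_2\xrightarrow{x_2|y_2}s_3\cdots$. A state is trivial if its transformation is the identity. The automaton $A$ is invertible if every state acts by an invertible transformation, and then $G_A$ denotes the group generated by the transformations of its states; it acts on the set $X^{\omega}$ of right-infinite words. The post-critical set of $A$ consists of all left-infinite words $\ldots x_2x_1$ and $\ldots y_2y_1$ such that $\ldots,x_2|y_2,x_1|y_1$ is the sequence of labels of a directed left-infinite path in $A$ ending at a non-trivial state. The automaton $A$ is bounded if it is invertible and its post-critical set is finite. **Corollary.** There exists an algorithm which, given a bounded automaton $A$ (by its numbers of states and letters and its transition-output table) and an eventually periodic sequence $w=uvvv\ldots\in X^{\omega}$ (by finite words $u$ and $v$ with $v$ nonempty), decides whether the $G_A$-orbit of $w$ is finite. -/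

import Mathlib

/-- An automaton (Mealy machine) with set of states `S` over the input-output alphabet `X`.
`A.step s x = (y, t)` is the arrow `s → t` labelled by `x | y`. -/
structure MealyAutomaton (S X : Type*) where
  step : S → X → X × S

namespace MealyAutomaton

section Action

variable {S X : Type*} (A : MealyAutomaton S X)

/-- The transformation of the space `X*` of finite words defined by the state `s`. -/
def act : S → List X → List X
  | _, [] => []
  | s, x :: v => (A.step s x).1 :: act (A.step s x).2 v

/-- The active state after the first `i` letters of the infinite word `w` have been read,
starting from the state `s`. -/
def run (s : S) (w : ℕ → X) : ℕ → S
  | 0 => s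
  | i + 1 => (A.step (run s w i) (w i)).2

/-- The transformation of the space `X^ω` of right-infinite words defined by the state `s`. -/
def actSeq (s : S) (w : ℕ → X) : ℕ → X :=
  fun i => (A.step (A.run s w i) (w i)).1

/-- Every state defines an invertible transformation on the space of words. -/
def IsInvertible : Prop :=
  ∀ s : S, Function.Bijective (A.act s)

/-- A trivial state: it defines the identity transformation. -/
def IsTrivialState (s : S) : Prop :=
  ∀ v : List X, A.act s v = v

/-- There is a directed left-infinite path in `A` with labels `…, x 1 | y 1, x 0 | y 0`
ending at the state `t`; left-infinite words are indexed from right to left. -/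
def IsLeftInfinitePath (x y : ℕ → X) (t : S) : Prop :=
  ∃ σ : ℕ → S, σ 0 = t ∧ ∀ i, A.step (σ (i + 1)) (x i) = (y i, σ i)

/-- The post-critical set: the input and the output labels of the directed left-infinite paths
ending at a non-trivial state. -/
def postCriticalSet : Set (ℕ → X) :=
  {p | ∃ (x y : ℕ → X) (t : S),
    A.IsLeftInfinitePath x y t ∧ ¬ A.IsTrivialState t ∧ (p = x ∨ p = y)}

/-- A bounded automaton: invertible, with finite post-critical set. -/
def IsBounded : Prop :=
  A.IsInvertible ∧ A.postCriticalSet.Finite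

/-- The automaton group, in its faithful action on `X^ω`: the group of permutations of `X^ω`
generated by the transformations defined by the states. -/
def group : Subgroup (Equiv.Perm (ℕ → X)) :=
  Subgroup.closure {g | ∃ s : S, ⇑g = A.actSeq s}

/-- For an invertible automaton every state does give a generator of the automaton group. -/
theorem IsInvertible.exists_perm [Finite X] {A : MealyAutomaton S X} (hA : A.IsInvertible)
    (s : S) : ∃ g ∈ A.group, ⇑g = A.actSeq s := by
  have hinj : ∀ t, Function.Injective fun x => (A.step t x).1 := by
    intro t x y hxy
    have h : A.act t [x] = A.act t [y] := by simpa [act] using hxy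
    simpa using (hA t).1 h
  have hsurj : ∀ t, Function.Surjective fun x => (A.step t x).1 :=
    fun t => Finite.injective_iff_surjective.1 (hinj t)
  have hbij : Function.Bijective (A.actSeq s) := by
    constructor
    · intro w w' h
      have key : ∀ i, A.run s w i = A.run s w' i ∧ w i = w' i := by
        intro i
        have letter : ∀ i, A.run s w i = A.run s w' i → w i = w' i := by
          intro i hi
          have h1 := congrFun h i
          simp only [actSeq, hi] at h1
          exact hinj _ h1
        induction i with
        | zero => exact ⟨rfl, letter 0 rfl⟩
        | succ i ih =>
          have h2 : A.run s w (i + 1) = A.run s w' (i + 1) := by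
            simp only [run, ih.1, ih.2]
          exact ⟨h2, letter _ h2⟩
      exact funext fun i => (key i).2
    · intro y
      choose inv hinv using hsurj
      let τ : ℕ → S := fun i => Nat.rec s (fun i t => (A.step t (inv t (y i))).2) i
      have hrun : ∀ i, A.run s (fun j => inv (τ j) (y j)) i = τ i := by
        intro i
        induction i with
        | zero => rfl
        | succ i ih => rw [run, ih]
      refine ⟨fun j => inv (τ j) (y j), funext fun i => ?_⟩
      simp only [actSeq, hrun]
      exact hinv (τ i) (y i)
  exact ⟨Equiv.ofBijective _ hbij, Subgroup.subset_closure ⟨s, rfl⟩, rfl⟩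

end Action

/-- The finite description of an automaton with states `0, …, n - 1` over the alphabet
`{0, …, k - 1}`: the numbers `n` and `k` and the transition-output table, whose entry in row `s`
and column `x` is `(y, t)` if `s → t` is the arrow labelled by `x | y`. -/
def code {n k : ℕ} (A : MealyAutomaton (Fin n) (Fin k)) : ℕ × ℕ × List (List (ℕ × ℕ)) :=
  (n, k, List.ofFn fun s => List.ofFn fun x => (((A.step s x).1 : ℕ), ((A.step s x).2 : ℕ)))

end MealyAutomaton

/-- The eventually periodic right-infinite word `u v v v …`, for a nonempty word `v`. -/
def eventuallyPeriodicWord {X : Type*} (u v : List X) (hv : v ≠ []) : ℕ → X := fun i =>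
  if h : i < u.length then u[i]
  else v[(i - u.length) % v.length]'(Nat.mod_lt _ (List.length_pos_iff.2 hv))

/-! Say that `w` branches at level `m` if the orbit of its prefix of length `m + 1` contains another
extension of the prefix of length `m`. For an invertible automaton the orbit of `w` is finite
exactly when `w` branches at finitely many levels (`IsInvertible.finite_orbit_iff`), so it is enough
to show that branching is periodic in `m` from a computable level on.

Remove from the action graph on words of length `m` the arrows with non-trivial section. What
remains is the tile graph, and the ends of the removed arrows are its boundary words. The next level
consists of copies of this tile graph, one for each letter, joined only at boundary words. Hence the
removed arrows, the connectedness of boundary words in the tile graph and their connectedness to the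
prefix of `w` determine both branching at level `m` and, together with the letter `w m`, the same
data one level up (`LevelIso.branches`, `LevelIso.succ`).

Finiteness of the post-critical set implies that a boundary word of given length is determined by
boundedly many end letters and one bit (`IsBounded.eq_of_boundaryCode_eq`). So the data take at most
`dataBound` values, a number computed from the numbers of states and letters. Two levels at the same
phase of the period of `w` carry equal data, and from there on branching repeats. With `M` bounding
both the preperiod and the period, it remains to test the levels from `M` to `2 * M - 1`, which is a
condition on the finite orbit of the prefix of length `2 * M`. -/

namespace MealyAutomaton

/-! ### Tile graphs and their boundary words -/

section Words

variable {S X : Type*} (A : MealyAutomaton S X)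

/-- The state reached from `s` after reading a finite word. -/
def sec : S → List X → S
  | s, [] => s
  | s, x :: v => sec (A.step s x).2 v

variable {A}

theorem act_concat (s : S) (v : List X) (x : X) :
    A.act s (v ++ [x]) = A.act s v ++ [(A.step (A.sec s v) x).1] := by
  induction v generalizing s with
  | nil => rfl
  | cons y v ih => simp [act, sec, ih]

theorem sec_concat (s : S) (v : List X) (x : X) :
    A.sec s (v ++ [x]) = (A.step (A.sec s v) x).2 := by
  induction v generalizing s with
  | nil => rfl
  | cons y v ih => simp [sec, ih]

theorem length_act (s : S) (v : List X) : (A.act s v).length = v.length := by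
  induction v generalizing s with
  | nil => rfl
  | cons y v ih => simp [act, ih]

theorem IsTrivialState.fst_step {t : S} (h : A.IsTrivialState t) (x : X) :
    (A.step t x).1 = x := by
  simpa [act] using h [x]

theorem IsTrivialState.snd_step {t : S} (h : A.IsTrivialState t) (x : X) :
    A.IsTrivialState (A.step t x).2 := fun v => by
  have := h (x :: v)
  simp only [act, List.cons.injEq] at this
  exact this.2

variable (A)

/-- A state transforms `v` to `v'` with section at `v` the non-trivial state `t`. -/
def NontrivialLink (t : S) (v v' : List X) : Prop :=
  ∃ s, A.act s v = v' ∧ A.sec s v = t ∧ ¬ A.IsTrivialState t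

/-- A state transforms `v` to `v'`; unless `full` holds, its section at `v` must be trivial. -/
def Link (full : Prop) (v v' : List X) : Prop :=
  ∃ s, A.act s v = v' ∧ (full ∨ A.IsTrivialState (A.sec s v))

/-- Connectedness in the graph of the action on words of a given length (if `full` holds), or
in the tile graph, which has only the arrows with trivial sections. -/
def Conn (full : Prop) : List X → List X → Prop :=
  Relation.ReflTransGen fun a b => A.Link full a b ∨ A.Link full b a

/-- Boundary words: the ends of the arrows with non-trivial sections. -/
def IsBoundary (v : List X) : Prop :=
  ∃ t v', A.NontrivialLink t v v' ∨ A.NontrivialLink t v' v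

variable {A}

theorem Conn.symm {full : Prop} {v v' : List X} (h : A.Conn full v v') : A.Conn full v' v := by
  induction h with
  | refl => exact Relation.ReflTransGen.refl
  | tail _ h ih => exact ih.head h.symm

theorem Conn.trans {full : Prop} {v v' v'' : List X} (h : A.Conn full v v')
    (h' : A.Conn full v' v'') : A.Conn full v v'' :=
  Relation.ReflTransGen.trans h h'

theorem Link.conn {full : Prop} {v v' : List X} (h : A.Link full v v') : A.Conn full v v' :=
  Relation.ReflTransGen.single (Or.inl h)

theorem Link.length_eq {full : Prop} {v v' : List X} (h : A.Link full v v') :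
    v'.length = v.length := by
  obtain ⟨s, rfl, -⟩ := h
  exact length_act s v

theorem NontrivialLink.length_eq {t : S} {v v' : List X} (h : A.NontrivialLink t v v') :
    v'.length = v.length := by
  obtain ⟨s, rfl, -⟩ := h
  exact length_act s v

theorem Conn.length_eq {full : Prop} {v v' : List X} (h : A.Conn full v v') :
    v'.length = v.length := by
  induction h with
  | refl => rfl
  | tail _ h ih => exact ih ▸ h.elim Link.length_eq fun h => h.length_eq.symm

theorem NontrivialLink.left {t : S} {v v' : List X} (h : A.NontrivialLink t v v') :
    A.IsBoundary v := ⟨t, v', Or.inl h⟩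

theorem NontrivialLink.right {t : S} {v v' : List X} (h : A.NontrivialLink t v v') :
    A.IsBoundary v' := ⟨t, v, Or.inr h⟩

/-- Sections of trivial states are trivial, so a non-trivial section at a longer word forces one at
the prefix. -/
theorem nontrivialLink_concat {t' : S} {v v' : List X} {x x' : X} :
    A.NontrivialLink t' (v ++ [x]) (v' ++ [x']) ↔
      ∃ t, A.NontrivialLink t v v' ∧ A.step t x = (x', t') ∧ ¬ A.IsTrivialState t' := by
  constructor
  · rintro ⟨s, h1, h2, h3⟩
    rw [act_concat, List.append_singleton_inj] at h1
    rw [sec_concat] at h2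
    refine ⟨A.sec s v, ⟨s, h1.1, rfl, fun h => h3 (h2 ▸ h.snd_step x)⟩, Prod.ext h1.2 h2, h3⟩
  · rintro ⟨_, ⟨s, rfl, rfl, -⟩, h1, h2⟩
    exact ⟨s, by rw [act_concat, h1], by rw [sec_concat, h1], h2⟩

/-- The self-similar rule for the next level: an arrow is either a copy of a tile arrow, which keeps
the last letter, or continues an arrow between boundary words. -/
theorem link_concat {full : Prop} {v v' : List X} {x x' : X} :
    A.Link full (v ++ [x]) (v' ++ [x']) ↔ (x = x' ∧ A.Link False v v') ∨
      ∃ t, A.NontrivialLink t v v' ∧ (A.step t x).1 = x' ∧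
        (full ∨ A.IsTrivialState (A.step t x).2) := by
  constructor
  · rintro ⟨s, h1, h2⟩
    rw [act_concat, List.append_singleton_inj] at h1
    rw [sec_concat] at h2
    by_cases h : A.IsTrivialState (A.sec s v)
    · exact Or.inl ⟨by rw [← h1.2, h.fst_step], s, h1.1, Or.inr h⟩
    · exact Or.inr ⟨_, ⟨s, h1.1, rfl, h⟩, h1.2, h2⟩
  · rintro (⟨rfl, s, rfl, h⟩ | ⟨_, ⟨s, rfl, rfl, -⟩, rfl, h2⟩)
    · have h := h.resolve_left id
      exact ⟨s, by rw [act_concat, h.fst_step], Or.inr (by rw [sec_concat]; exact h.snd_step x)⟩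
    · exact ⟨s, by rw [act_concat], by rwa [sec_concat]⟩

theorem Conn.concat {full : Prop} {v v' : List X} (h : A.Conn False v v') (x : X) :
    A.Conn full (v ++ [x]) (v' ++ [x]) := by
  induction h with
  | refl => exact Relation.ReflTransGen.refl
  | tail _ h ih =>
    exact ih.tail (h.imp (fun h => link_concat.2 (Or.inl ⟨rfl, h⟩))
      fun h => link_concat.2 (Or.inl ⟨rfl, h⟩))

/-- The last letter can change only across an arrow with non-trivial section, and a tile component
free of boundary words has none. -/
theorem Conn.of_concat {v v' : List X} {x x' : X} {full : Prop}
    (h : A.Conn full (v ++ [x]) (v' ++ [x']))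
    (hv : ∀ p, A.IsBoundary p → ¬ A.Conn False v p) : x = x' := by
  have key : ∀ b, A.Conn full (v ++ [x]) b → ∃ u, b = u ++ [x] ∧ A.Conn False v u := by
    intro b hb
    induction hb with
    | refl => exact ⟨v, rfl, Relation.ReflTransGen.refl⟩
    | @tail b c hb hc ih =>
      obtain ⟨u, rfl, hu⟩ := ih
      have hl : c.length = (u ++ [x]).length :=
        hc.elim Link.length_eq fun h => h.length_eq.symm
      obtain ⟨u', y, rfl⟩ := (List.eq_nil_or_concat' c).resolve_left (by rintro rfl; simp at hl)
      rcases hc with hc | hc <;> rw [link_concat] at hc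
      · rcases hc with ⟨rfl, hc⟩ | ⟨t, hc, -⟩
        · exact ⟨u', rfl, hu.tail (Or.inl hc)⟩
        · exact absurd hu (hv _ hc.left)
      · rcases hc with ⟨rfl, hc⟩ | ⟨t, hc, -⟩
        · exact ⟨u', rfl, hu.tail (Or.inr hc)⟩
        · exact absurd hu (hv _ hc.right)
  obtain ⟨u, hu, -⟩ := key _ h
  exact ((List.append_singleton_inj.1 hu).2).symm

/-- The prefix of length `m` of an infinite word. -/
def pref (w : ℕ → X) (m : ℕ) : List X := (List.range m).map w

theorem pref_succ (w : ℕ → X) (m : ℕ) : pref w (m + 1) = pref w m ++ [w m] := by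
  simp [pref, List.range_succ]

theorem length_pref (w : ℕ → X) (m : ℕ) : (pref w m).length = m := by simp [pref]

/-! ### Correspondences between two levels -/

variable (A)

/-- A correspondence between the boundary words of lengths `m` and `m'` which respects the arrows
with non-trivial sections and connectedness in the tile graphs, also to the prefixes of `w`. -/
structure LevelIso (w : ℕ → X) (m m' : ℕ) (φ : List X → List X → Prop) : Prop where
  left : ∀ v u, φ v u → v.length = m ∧ A.IsBoundary v
  right : ∀ v u, φ v u → u.length = m' ∧ A.IsBoundary u
  total_left : ∀ v, v.length = m → A.IsBoundary v → ∃ u, φ v u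
  total_right : ∀ u, u.length = m' → A.IsBoundary u → ∃ v, φ v u
  link : ∀ t v u v' u', φ v u → φ v' u' → (A.NontrivialLink t v v' ↔ A.NontrivialLink t u u')
  conn : ∀ v u v' u', φ v u → φ v' u' → (A.Conn False v v' ↔ A.Conn False u u')
  base : ∀ v u, φ v u → (A.Conn False v (pref w m) ↔ A.Conn False u (pref w m'))

variable {A}

namespace LevelIso

variable {w : ℕ → X} {m m' : ℕ} {φ : List X → List X → Prop}

theorem symm (h : A.LevelIso w m m' φ) : A.LevelIso w m' m (flip φ) where
  left v u := h.right u v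
  right v u := h.left u v
  total_left := h.total_right
  total_right := h.total_left
  link t v u v' u' h1 h2 := (h.link t u v u' v' h1 h2).symm
  conn v u v' u' h1 h2 := (h.conn u v u' v' h1 h2).symm
  base v u h1 := (h.base u v h1).symm

/-- Only boundary words have counterparts, so a path is mirrored through an anchor: a boundary word
`q` in the tile component of the current word, whose counterpart `r` has been reached with the same
last letter. -/
theorem conn_concat (h : A.LevelIso w m m' φ) {full : Prop} {p u v : List X} {x y : X}
    (hpu : φ p u) (hc : A.Conn full (p ++ [x]) (v ++ [y])) :
    ∃ q r, φ q r ∧ A.Conn False q v ∧ A.Conn full (u ++ [x]) (r ++ [y]) := by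
  have key : ∀ b, A.Conn full (p ++ [x]) b → ∃ v y, b = v ++ [y] ∧
      ∃ q r, φ q r ∧ A.Conn False q v ∧ A.Conn full (u ++ [x]) (r ++ [y]) := by
    intro b hb
    induction hb with
    | refl => exact ⟨p, x, rfl, p, u, hpu, Relation.ReflTransGen.refl, Relation.ReflTransGen.refl⟩
    | @tail b c hb hc ih =>
      obtain ⟨v, y, rfl, q, r, hqr, hqv, hur⟩ := ih
      have hl : c.length = (v ++ [y]).length :=
        hc.elim Link.length_eq fun h => h.length_eq.symm
      obtain ⟨v', y', rfl⟩ := (List.eq_nil_or_concat' c).resolve_left (by rintro rfl; simp at hl)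
      have hv : v.length = m := hqv.length_eq.trans (h.left _ _ hqr).1
      have hv' : v'.length = m := by simpa [hv] using hl
      refine ⟨v', y', rfl, ?_⟩
      rcases hc with hc | hc <;> rw [link_concat] at hc
      · rcases hc with ⟨rfl, hc⟩ | ⟨t, hc, hy, ht⟩
        -- The path stays inside one copy of the tile graph, and the anchor is kept.
        · exact ⟨q, r, hqr, hqv.tail (Or.inl hc), hur⟩
        -- The path leaves the copy. On the other side, walk inside the copy from the old anchor to
        -- the counterpart of `v`, then cross the matching arrow; `v'` is the new anchor.
        · obtain ⟨r1, h1⟩ := h.total_left _ hv hc.left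
          obtain ⟨r2, h2⟩ := h.total_left _ hv' hc.right
          refine ⟨v', r2, h2, Relation.ReflTransGen.refl, hur.trans ?_⟩
          refine (((h.conn _ _ _ _ hqr h1).1 hqv).concat y).tail (Or.inl ?_)
          exact link_concat.2 (Or.inr ⟨t, (h.link t _ _ _ _ h1 h2).1 hc, hy, ht⟩)
      · rcases hc with ⟨rfl, hc⟩ | ⟨t, hc, hy, ht⟩
        · exact ⟨q, r, hqr, hqv.tail (Or.inr hc), hur⟩
        · obtain ⟨r1, h1⟩ := h.total_left _ hv hc.right
          obtain ⟨r2, h2⟩ := h.total_left _ hv' hc.left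
          refine ⟨v', r2, h2, Relation.ReflTransGen.refl, hur.trans ?_⟩
          refine (((h.conn _ _ _ _ hqr h1).1 hqv).concat y).tail (Or.inr ?_)
          exact link_concat.2 (Or.inr ⟨t, (h.link t _ _ _ _ h2 h1).1 hc, hy, ht⟩)
  obtain ⟨v', y', hb, hr⟩ := key _ hc
  obtain ⟨rfl, rfl⟩ := List.append_singleton_inj.1 hb
  exact hr

theorem link_concat_iff (h : A.LevelIso w m m' φ) {t : S} {v u v' u' : List X} {x x' : X}
    (h1 : φ v u) (h2 : φ v' u') :
    A.NontrivialLink t (v ++ [x]) (v' ++ [x']) ↔ A.NontrivialLink t (u ++ [x]) (u' ++ [x']) := by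
  simp only [nontrivialLink_concat, h.link _ _ _ _ _ h1 h2]

theorem isBoundary_concat (h : A.LevelIso w m m' φ) {v u : List X} {x : X} (h1 : φ v u)
    (hv : A.IsBoundary (v ++ [x])) : A.IsBoundary (u ++ [x]) := by
  have hm := (h.left _ _ h1).1
  obtain ⟨t, b, hb⟩ := hv
  have hl : b.length = (v ++ [x]).length := hb.elim (·.length_eq) fun h => h.length_eq.symm
  obtain ⟨v', y, rfl⟩ := (List.eq_nil_or_concat' b).resolve_left (by rintro rfl; simp at hl)
  have hv' : v'.length = m := by simpa [hm] using hl
  have hbd : A.IsBoundary v' := by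
    rcases hb with hb | hb <;> obtain ⟨t', hb, -⟩ := nontrivialLink_concat.1 hb
    exacts [hb.right, hb.left]
  obtain ⟨u', h2⟩ := h.total_left _ hv' hbd
  exact ⟨t, u' ++ [y], hb.imp (h.link_concat_iff h1 h2).1 (h.link_concat_iff h2 h1).1⟩

theorem isBoundary_of_concat {v : List X} {x : X} (hv : A.IsBoundary (v ++ [x])) :
    A.IsBoundary v := by
  obtain ⟨t, b, hb⟩ := hv
  have hl : b.length = (v ++ [x]).length := hb.elim (·.length_eq) fun h => h.length_eq.symm
  obtain ⟨v', y, rfl⟩ := (List.eq_nil_or_concat' b).resolve_left (by rintro rfl; simp at hl)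
  rcases hb with hb | hb <;> obtain ⟨t', hb, -⟩ := nontrivialLink_concat.1 hb
  exacts [hb.left, hb.right]

theorem total_succ (h : A.LevelIso w m m' φ) {b : List X} (hl : b.length = m + 1)
    (hb : A.IsBoundary b) : ∃ v u x, b = v ++ [x] ∧ φ v u ∧ A.IsBoundary (u ++ [x]) := by
  obtain ⟨v, x, rfl⟩ := (List.eq_nil_or_concat' b).resolve_left (by rintro rfl; simp at hl)
  obtain ⟨u, hu⟩ := h.total_left v (by simpa using hl) (isBoundary_of_concat hb)
  exact ⟨v, u, x, rfl, hu, h.isBoundary_concat hu hb⟩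

theorem conn_succ (h : A.LevelIso w m m' φ) {v u v' u' : List X} {x x' : X}
    (h1 : φ v u) (h2 : φ v' u') (hc : A.Conn False (v ++ [x]) (v' ++ [x'])) :
    A.Conn False (u ++ [x]) (u' ++ [x']) := by
  obtain ⟨q, r, hqr, hq, hr⟩ := h.conn_concat h1 hc
  exact hr.trans (((h.conn _ _ _ _ hqr h2).1 hq).concat x')

theorem base_succ (h : A.LevelIso w m m' φ) {v u : List X} {x y : X} (h1 : φ v u)
    (hc : A.Conn False (v ++ [x]) (pref w m ++ [y])) :
    A.Conn False (u ++ [x]) (pref w m' ++ [y]) := by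
  obtain ⟨q, r, hqr, hq, hr⟩ := h.conn_concat h1 hc
  exact hr.trans (((h.base _ _ hqr).1 hq).concat y)

/-- Append equal letters to corresponding words. The hypothesis on `w` makes the prefixes extend by
the same letter too. -/
theorem succ (h : A.LevelIso w m m' φ) (hw : w m = w m') :
    A.LevelIso w (m + 1) (m' + 1)
      (fun a b => ∃ v u x, a = v ++ [x] ∧ b = u ++ [x] ∧ φ v u ∧ A.IsBoundary a) where
  left := by
    rintro _ _ ⟨v, u, x, rfl, rfl, h1, h2⟩
    exact ⟨by simp [(h.left _ _ h1).1], h2⟩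
  right := by
    rintro _ _ ⟨v, u, x, rfl, rfl, h1, h2⟩
    exact ⟨by simp [(h.right _ _ h1).1], h.isBoundary_concat h1 h2⟩
  total_left b hl hb := by
    obtain ⟨v, u, x, rfl, h1, h2⟩ := h.total_succ hl hb
    exact ⟨u ++ [x], v, u, x, rfl, rfl, h1, hb⟩
  total_right b hl hb := by
    obtain ⟨v, u, x, rfl, h1, h2⟩ := h.symm.total_succ hl hb
    exact ⟨u ++ [x], u, v, x, rfl, rfl, h1, h2⟩
  link := by
    rintro t _ _ _ _ ⟨v, u, x, rfl, rfl, h1, -⟩ ⟨v', u', x', rfl, rfl, h2, -⟩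
    exact h.link_concat_iff h1 h2
  conn := by
    rintro _ _ _ _ ⟨v, u, x, rfl, rfl, h1, -⟩ ⟨v', u', x', rfl, rfl, h2, -⟩
    exact ⟨h.conn_succ h1 h2, h.symm.conn_succ h1 h2⟩
  base := by
    rintro _ _ ⟨v, u, x, rfl, rfl, h1, -⟩
    rw [pref_succ, pref_succ, ← hw]
    exact ⟨h.base_succ h1, h.symm.base_succ h1⟩

end LevelIso

/-! ### Branching levels -/

variable (A)

/-- The orbit of the prefix of length `m + 1` contains another extension of the prefix of
length `m`. -/
def Branches (w : ℕ → X) (m : ℕ) : Prop :=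
  ∃ x, x ≠ w m ∧ A.Conn True (pref w (m + 1)) (pref w m ++ [x])

variable {A}

/-- Branching changes the last letter, so the tile component of the prefix contains a boundary word.
Join the prefix to it, mirror the path from there, and return to the prefix on the other side by
`base`. -/
theorem LevelIso.branches {w : ℕ → X} {m m' : ℕ} {φ : List X → List X → Prop}
    (h : A.LevelIso w m m' φ) (hw : w m = w m') (hb : A.Branches w m) : A.Branches w m' := by
  obtain ⟨x, hx, hc⟩ := hb
  rw [pref_succ] at hc
  have : ∃ p, A.IsBoundary p ∧ A.Conn False (pref w m) p := by
    by_contra! hv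
    exact hx (hc.of_concat hv).symm
  obtain ⟨p, hp, hpm⟩ := this
  obtain ⟨u, hu⟩ := h.total_left p (by rw [hpm.length_eq, length_pref]) hp
  obtain ⟨q, r, hqr, hq, hr⟩ := h.conn_concat hu ((hpm.symm.concat (w m)).trans hc)
  refine ⟨x, hw ▸ hx, ?_⟩
  rw [pref_succ, ← hw]
  exact ((((h.base _ _ hu).1 hpm.symm).symm.concat (w m)).trans hr).trans
    (((h.base _ _ hqr).1 hq).concat x)

theorem LevelIso.branches_add {w : ℕ → X} {m m' : ℕ} {φ : List X → List X → Prop}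
    (h : A.LevelIso w m m' φ) (hw : ∀ i, w (m + i) = w (m' + i)) (i : ℕ) :
    A.Branches w (m + i) ↔ A.Branches w (m' + i) := by
  have : ∃ ψ, A.LevelIso w (m + i) (m' + i) ψ := by
    induction i with
    | zero => exact ⟨φ, h⟩
    | succ i ih =>
      obtain ⟨ψ, hψ⟩ := ih
      exact ⟨_, hψ.succ (hw i)⟩
  obtain ⟨ψ, hψ⟩ := this
  exact ⟨hψ.branches (hw i), hψ.symm.branches (hw i).symm⟩

end Words

end MealyAutomaton

/-! ### Finite languages of left-infinite words -/

section LeftLanguage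

variable {S X : Type*} (Δ : S → X → S → Prop) (F : Set S)

/-- The left-infinite words read along the paths ending in `F`, for a labelled graph `Δ`. -/
def leftLanguage : Set (ℕ → X) :=
  {e | ∃ σ : ℕ → S, σ 0 ∈ F ∧ ∀ i, Δ (σ (i + 1)) (e i) (σ i)}

/-- The starting points of the paths ending in `F` along which the last `m` letters of `e`
are read. -/
def startSet (e : ℕ → X) : ℕ → Set S
  | 0 => F
  | m + 1 => {s | ∃ t ∈ startSet e m, Δ s (e m) t}

variable {Δ F}

theorem mem_startSet {e : ℕ → X} {σ : ℕ → S} {m : ℕ} (h0 : σ 0 ∈ F)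
    (h : ∀ i < m, Δ (σ (i + 1)) (e i) (σ i)) : σ m ∈ startSet Δ F e m := by
  induction m with
  | zero => exact h0
  | succ m ih => exact ⟨σ m, ih fun i hi => h i (by omega), h m (by omega)⟩

theorem exists_path_of_mem_startSet {e : ℕ → X} {m : ℕ} {s : S} (h : s ∈ startSet Δ F e m) :
    ∃ σ : ℕ → S, σ 0 ∈ F ∧ σ m = s ∧ ∀ i < m, Δ (σ (i + 1)) (e i) (σ i) := by
  induction m generalizing s with
  | zero => exact ⟨fun _ => s, h, rfl, by simp⟩
  | succ m ih =>
    obtain ⟨t, ht, hst⟩ := h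
    obtain ⟨σ, h0, hm, hσ⟩ := ih ht
    refine ⟨fun i => if i ≤ m then σ i else s, by simpa, by simp, fun i hi => ?_⟩
    rcases Nat.lt_succ_iff_lt_or_eq.1 hi with hi | rfl
    · simpa [hi.le, Nat.succ_le_iff.2 hi] using hσ i hi
    · simpa [hm] using hst

theorem startSet_congr {e e' : ℕ → X} {m : ℕ} (h : ∀ i < m, e i = e' i) :
    startSet Δ F e m = startSet Δ F e' m := by
  induction m with
  | zero => rfl
  | succ m ih => rw [startSet, startSet, ih fun i hi => h i (by omega), h m (by omega)]

/-- The block of letters from `i` to `j - 1` is read once more: equal start sets let the tail of the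
path beyond `i` be glued at position `j`. -/
theorem pump_mem_leftLanguage {e : ℕ → X} {i j : ℕ} (hij : i ≤ j) (he : e ∈ leftLanguage Δ F)
    (h : startSet Δ F e i = startSet Δ F e j) :
    (fun l => if l < j then e l else e (l - (j - i))) ∈ leftLanguage Δ F := by
  obtain ⟨σ, h0, hσ⟩ := he
  have hi : σ i ∈ startSet Δ F e j := h ▸ mem_startSet h0 fun l _ => hσ l
  obtain ⟨τ, hτ0, hτj, hτ⟩ := exists_path_of_mem_startSet hi
  refine ⟨fun l => if l < j then τ l else σ (l - (j - i)), ?_, fun l => ?_⟩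
  · by_cases hj : 0 < j
    · simpa [hj] using hτ0
    · simpa [hj] using h0
  · rcases lt_trichotomy (l + 1) j with hl | hl | hl
    · simpa [hl, show l < j by omega] using hτ l (by omega)
    · have h1 := hτ l (by omega)
      rw [hl, hτj] at h1
      simpa [hl, show l < j by omega, show j - (j - i) = i by omega] using h1
    · have h1 := hσ (l - (j - i))
      simpa [show ¬ l + 1 < j by omega, show ¬ l < j by omega,
        show l + 1 - (j - i) = l - (j - i) + 1 by omega] using h1

/-- Two of the first `2 ^ Nat.card S + 1` start sets coincide, at `i < j`. Pumping maps the words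
that share the first `j` letters of `e` injectively to themselves. By finiteness it is onto, so each
of these words is pumped arbitrarily often and all its letters are forced. -/
theorem eq_of_mem_leftLanguage [Finite S] (hfin : (leftLanguage Δ F).Finite) {e e' : ℕ → X}
    (he : e ∈ leftLanguage Δ F) (he' : e' ∈ leftLanguage Δ F)
    (h : ∀ i < 2 ^ Nat.card S, e i = e' i) : e = e' := by
  obtain ⟨i, j, hij, hj, hQ⟩ : ∃ i j, i < j ∧ j ≤ 2 ^ Nat.card S ∧
      startSet Δ F e i = startSet Δ F e j := by
    have := Fintype.ofFinite S
    obtain ⟨a, b, hab, hQ⟩ := Fintype.exists_ne_map_eq_of_card_lt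
      (fun a : Fin (2 ^ Nat.card S + 1) => startSet Δ F e a) (by simp)
    rcases lt_or_gt_of_ne hab with hab | hab
    exacts [⟨a, b, hab, by omega, hQ⟩, ⟨b, a, hab, by omega, hQ.symm⟩]
  let E : Set (ℕ → X) := {f | f ∈ leftLanguage Δ F ∧ ∀ l < j, f l = e l}
  let T : (ℕ → X) → ℕ → X := fun f l => if l < j then f l else f (l - (j - i))
  have hT : Set.MapsTo T E E := by
    rintro f ⟨hf, hfe⟩
    refine ⟨pump_mem_leftLanguage hij.le hf ?_, fun l hl => ?_⟩
    · rw [startSet_congr fun l hl => hfe l (by omega), startSet_congr hfe, hQ]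
    · simpa [T, hl] using hfe l hl
  have hTinj : Set.InjOn T E := by
    rintro f ⟨-, hf⟩ g ⟨-, hg⟩ hfg
    funext l
    by_cases hl : l < j
    · rw [hf l hl, hg l hl]
    · have := congrFun hfg (l + (j - i))
      simpa [T, show ¬ l + (j - i) < j by omega] using this
  have hTsurj : Set.SurjOn T E E :=
    (((hfin.subset fun _ h => h.1).injOn_iff_bijOn_of_mapsTo hT).1 hTinj).surjOn
  have key : ∀ r, ∀ f ∈ E, ∀ g ∈ E, ∀ l < r, f l = g l := by
    intro r
    induction r with
    | zero => simp
    | succ r ih =>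
      intro f hf g hg l hl
      obtain ⟨f, hf₁, rfl⟩ := hTsurj hf
      obtain ⟨g, hg₁, rfl⟩ := hTsurj hg
      by_cases hlj : l < j
      · rw [hf.2 l hlj, hg.2 l hlj]
      · simpa [T, hlj] using ih f hf₁ g hg₁ (l - (j - i)) (by omega)
  exact funext fun l => key (l + 1) e ⟨he, fun _ _ => rfl⟩ e'
    ⟨he', fun l hl => (h l (by omega)).symm⟩ l (by omega)

/-- A state repeats among the last `Nat.card S + 1` states of the finite path; going round that loop
forever changes no earlier letter. -/
theorem exists_mem_leftLanguage [Finite S] {e : ℕ → X} {m : ℕ} {σ : ℕ → S} (h0 : σ 0 ∈ F)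
    (hσ : ∀ i < m, Δ (σ (i + 1)) (e i) (σ i)) (hm : Nat.card S ≤ m) :
    ∃ f ∈ leftLanguage Δ F, ∀ i < m - Nat.card S, f i = e i := by
  obtain ⟨a, b, hab, ha, hb, hs⟩ : ∃ a b, a < b ∧ m - Nat.card S ≤ a ∧ b ≤ m ∧ σ a = σ b := by
    have := Fintype.ofFinite S
    obtain ⟨a, b, hab, hs⟩ := Fintype.exists_ne_map_eq_of_card_lt
      (fun a : Fin (Nat.card S + 1) => σ (m - Nat.card S + a)) (by simp)
    rcases lt_or_gt_of_ne hab with hab | hab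
    exacts [⟨_, _, Nat.add_lt_add_left hab _, by omega, by omega, hs⟩,
      ⟨_, _, Nat.add_lt_add_left hab _, by omega, by omega, hs.symm⟩]
  -- Positions of the finite path visited by the looped one: up to `a`, then cyclically through `a,
  -- …, b - 1`.
  let c : ℕ → ℕ := fun i => if i < a then i else a + (i - a) % (b - a)
  have hc : ∀ i, c i < m ∧ (c (i + 1) = c i + 1 ∨ c i + 1 = b ∧ c (i + 1) = a) := by
    intro i
    have hlt := Nat.mod_lt (i - a) (show b - a > 0 by omega)
    refine ⟨by simp only [c]; split_ifs <;> omega, ?_⟩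
    rcases lt_trichotomy (i + 1) a with hi | hi | hi
    · exact Or.inl (by simp [c, hi, show i < a by omega])
    · exact Or.inl (by simp [c, hi, show i < a by omega])
    · simp only [c, show ¬ i + 1 < a by omega, show ¬ i < a by omega, if_false,
        show i + 1 - a = i - a + 1 by omega]
      by_cases hlast : (i - a) % (b - a) + 1 = b - a
      · right
        refine ⟨by omega, ?_⟩
        rw [Nat.add_mod, Nat.mod_eq_zero_of_dvd, add_zero]
        rcases Nat.lt_or_ge 1 (b - a) with h1 | h1
        · rw [Nat.mod_eq_of_lt h1, hlast]
        · rw [show b - a = 1 by omega]; simp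
      · left
        rw [Nat.add_mod, Nat.mod_eq_of_lt (show 1 < b - a by omega),
          Nat.mod_eq_of_lt (by omega), add_assoc]
  refine ⟨e ∘ c, ⟨σ ∘ c, ?_, fun i => ?_⟩, fun i hi => ?_⟩
  · by_cases h : 0 < a
    · simpa [c, h] using h0
    · simpa [c, h, show a = 0 by omega] using h0
  · have h1 := hσ (c i) (hc i).1
    rcases (hc i).2 with h2 | ⟨h2, h3⟩
    · simpa [h2] using h1
    · rw [h2, ← hs] at h1
      simpa [h3] using h1
  · simp [c, show i < a by omega]

/-- A finite path extends to an infinite one after changing at most its last `Nat.card S` letters,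
and the infinite word is determined by its first `2 ^ Nat.card S` letters. -/
theorem eq_of_startSet_nonempty [Finite S] (hfin : (leftLanguage Δ F).Finite) {e e' : ℕ → X}
    {m : ℕ} (he : (startSet Δ F e m).Nonempty) (he' : (startSet Δ F e' m).Nonempty)
    (h : ∀ i < 2 ^ Nat.card S, i < m → e i = e' i)
    (h' : ∀ i < m, m - Nat.card S ≤ i → e i = e' i) : ∀ i < m, e i = e' i := by
  intro i hi
  by_cases hi1 : i < 2 ^ Nat.card S
  · exact h i hi1 hi
  by_cases hi2 : m - Nat.card S ≤ i
  · exact h' i hi hi2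
  obtain ⟨s, hs⟩ := he
  obtain ⟨σ, h0, -, hσ⟩ := exists_path_of_mem_startSet hs
  obtain ⟨s', hs'⟩ := he'
  obtain ⟨σ', h0', -, hσ'⟩ := exists_path_of_mem_startSet hs'
  obtain ⟨f, hf, hfe⟩ := exists_mem_leftLanguage h0 hσ (by omega)
  obtain ⟨f', hf', hfe'⟩ := exists_mem_leftLanguage h0' hσ' (by omega)
  have : f = f' := eq_of_mem_leftLanguage hfin hf hf' fun l hl => by
    rw [hfe l (by omega), hfe' l (by omega), h l hl (by omega)]
  rw [← hfe i (by omega), ← hfe' i (by omega), this]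

end LeftLanguage

/-! ### Codes of boundary words -/

section BoundaryCode

variable {S X : Type*}

/-- The first `n` and the last `2 ^ n` letters of a word, where `n` is the number of states. -/
def endLetters (S : Type*) (v : List X) :
    (Fin (Nat.card S) → Option X) × (Fin (2 ^ Nat.card S) → Option X) :=
  (fun i => v[(i : ℕ)]?, fun i => v.reverse[(i : ℕ)]?)

/-- Left-infinite words are indexed from the right, hence the reversals. The letter `d` is padding
beyond the word and is never read. -/
theorem eq_of_endLetters_eq [Finite S] {Δ : S → X → S → Prop} {F : Set S}
    (hfin : (leftLanguage Δ F).Finite) {v v' : List X} (d : X) (hl : v.length = v'.length)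
    (hv : (startSet Δ F (fun i => v.reverse.getD i d) v.length).Nonempty)
    (hv' : (startSet Δ F (fun i => v'.reverse.getD i d) v.length).Nonempty)
    (h : endLetters S v = endLetters S v') : v = v' := by
  have key := eq_of_startSet_nonempty hfin hv hv'
    (fun i hi _ => by
      have := congrFun (congrArg Prod.snd h) ⟨i, hi⟩
      simp only [endLetters] at this
      simp only [List.getD_eq_getElem?_getD, this])
    (fun i hi hi' => by
      have := congrFun (congrArg Prod.fst h) ⟨v.length - 1 - i, by omega⟩
      simp only [endLetters] at this
      simp only [List.getD_eq_getElem?_getD]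
      rw [List.getElem?_reverse hi, List.getElem?_reverse (hl ▸ hi), ← hl, this])
  apply List.reverse_injective
  refine List.ext_getElem (by simpa using hl) fun i h1 h2 => ?_
  have := key i (by simpa using h1)
  rwa [List.getD_eq_getElem _ _ h1, List.getD_eq_getElem _ _ h2] at this

end BoundaryCode

namespace MealyAutomaton

section Boundary

variable {S X : Type*} {A : MealyAutomaton S X}

theorem exists_path (s : S) (v : List X) (d : X) :
    ∃ σ : ℕ → S, σ 0 = A.sec s v ∧ ∀ i < v.length,
      A.step (σ (i + 1)) (v.reverse.getD i d) = ((A.act s v).reverse.getD i d, σ i) := by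
  induction v using List.reverseRecOn with
  | nil => exact ⟨fun _ => s, rfl, by simp⟩
  | append_singleton v x ih =>
    obtain ⟨σ, h0, hσ⟩ := ih
    refine ⟨fun i => Nat.casesOn i (A.sec s (v ++ [x])) σ, rfl, fun i hi => ?_⟩
    rw [act_concat, List.reverse_append, List.reverse_append]
    cases i with
    | zero => simp [h0, sec_concat]
    | succ i => exact hσ i (by simpa using hi)

variable (A) in
/-- A code for the boundary words of each length. -/
def boundaryCode (v : List X) :
    Prop × (Fin (Nat.card S) → Option X) × (Fin (2 ^ Nat.card S) → Option X) :=
  (∃ s, ¬ A.IsTrivialState (A.sec s v), endLetters S v)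

theorem IsBoundary.exists_sec {v : List X} (h : A.IsBoundary v) :
    ∃ s, ¬ A.IsTrivialState (A.sec s v) ∨
      ∃ v', A.act s v' = v ∧ ¬ A.IsTrivialState (A.sec s v') := by
  obtain ⟨t, v', ⟨s, -, rfl, hs⟩ | ⟨s, h1, rfl, hs⟩⟩ := h
  exacts [⟨s, Or.inl hs⟩, ⟨s, Or.inr ⟨v', h1, hs⟩⟩]

/-- A boundary word is the input or the output of a path to a non-trivial state. Input and output
labels form the left languages of two different graphs, both finite as parts of the post-critical
set; the bit in the code ensures that both words are treated in the same graph. -/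
theorem IsBounded.eq_of_boundaryCode_eq [Finite S] (hA : A.IsBounded) {v v' : List X}
    (hv : A.IsBoundary v) (hv' : A.IsBoundary v') (hl : v.length = v'.length)
    (h : A.boundaryCode v = A.boundaryCode v') : v = v' := by
  -- A non-empty word supplies the padding letter `d`.
  cases v with
  | nil => exact (List.length_eq_zero_iff.1 hl.symm).symm
  | cons d v =>
  generalize d :: v = v at *
  obtain ⟨hin, hends⟩ := Prod.ext_iff.1 h
  change (∃ s, _) = (∃ s, _) at hin
  by_cases hs : ∃ s, ¬ A.IsTrivialState (A.sec s v)
  · have hs' := hs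
    rw [hin] at hs'
    have hfin : (leftLanguage (fun s x t => (A.step s x).2 = t)
        {t | ¬ A.IsTrivialState t}).Finite := by
      refine hA.2.subset ?_
      rintro x ⟨σ, h0, hσ⟩
      exact ⟨x, fun i => (A.step (σ (i + 1)) (x i)).1, σ 0, ⟨σ, rfl, fun i =>
        Prod.ext rfl (hσ i)⟩, h0, Or.inl rfl⟩
    have key : ∀ u : List X, (∃ s, ¬ A.IsTrivialState (A.sec s u)) →
        (startSet (fun s x t => (A.step s x).2 = t) {t | ¬ A.IsTrivialState t}
          (fun i => u.reverse.getD i d) u.length).Nonempty := by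
      rintro u ⟨s, hs⟩
      obtain ⟨σ, h0, hσ⟩ := A.exists_path s u d
      exact ⟨_, mem_startSet (σ := σ) (by simpa [h0] using hs) fun i hi => by simp only [hσ i hi]⟩
    exact eq_of_endLetters_eq hfin d hl (key v hs) (hl ▸ key v' hs') hends
  · have hs' := hs
    rw [hin] at hs'
    have hfin : (leftLanguage (fun s y t => ∃ x, A.step s x = (y, t))
        {t | ¬ A.IsTrivialState t}).Finite := by
      refine hA.2.subset ?_
      rintro y ⟨σ, h0, hσ⟩
      choose x hx using hσ
      exact ⟨x, y, σ 0, ⟨σ, rfl, hx⟩, h0, Or.inr rfl⟩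
    have key : ∀ u : List X, A.IsBoundary u → (¬ ∃ s, ¬ A.IsTrivialState (A.sec s u)) →
        (startSet (fun s y t => ∃ x, A.step s x = (y, t)) {t | ¬ A.IsTrivialState t}
          (fun i => u.reverse.getD i d) u.length).Nonempty := by
      intro u hu hs
      obtain ⟨s, hs1 | ⟨v', rfl, hs1⟩⟩ := hu.exists_sec
      · exact absurd ⟨s, hs1⟩ hs
      · obtain ⟨σ, h0, hσ⟩ := A.exists_path s v' d
        exact ⟨_, mem_startSet (σ := σ) (by simpa [h0] using hs1) fun i hi =>
          ⟨_, hσ i (by simpa [length_act] using hi)⟩⟩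
    exact eq_of_endLetters_eq hfin d hl (key v hv hs) (hl ▸ key v' hv' hs') hends

/-- The coded form of the data respected by a `LevelIso`. -/
def levelData {I : Type*} (A : MealyAutomaton S X) (c : List X → I) (w : ℕ → X) (m : ℕ) :
    Set (S × I × I) × Set (I × I) × Set I :=
  ({p | ∃ v v', v.length = m ∧ A.NontrivialLink p.1 v v' ∧ (c v, c v') = p.2},
    {p | ∃ v v', v.length = m ∧ A.IsBoundary v ∧ A.IsBoundary v' ∧ A.Conn False v v' ∧
      (c v, c v') = p},
    {p | ∃ v, A.IsBoundary v ∧ A.Conn False v (pref w m) ∧ c v = p})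

/-- Codes are injective on the boundary words of each length, so equality of codes is the
correspondence. The reflexive pairs in the second component record which codes occur, which gives
totality. -/
theorem levelIso_of_levelData_eq {I : Type*} {c : List X → I}
    (hc : ∀ v v', A.IsBoundary v → A.IsBoundary v' → v.length = v'.length → c v = c v' → v = v')
    {w : ℕ → X} {m m' : ℕ} (h : levelData A c w m = levelData A c w m') :
    A.LevelIso w m m' (fun v u => (v.length = m ∧ A.IsBoundary v) ∧
      (u.length = m' ∧ A.IsBoundary u) ∧ c v = c u) := by
  have hlink : ∀ {m m' : ℕ}, levelData A c w m = levelData A c w m' → ∀ {t v u v' u'},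
      v.length = m → u.length = m' → A.IsBoundary u → u'.length = m' → A.IsBoundary u' →
      c v = c u → c v' = c u' → A.NontrivialLink t v v' → A.NontrivialLink t u u' := by
    intro m m' h t v u v' u' hm hu hbu hu' hbu' h1 h2 hvv
    have : (t, c v, c v') ∈ (levelData A c w m).1 := ⟨v, v', hm, hvv, rfl⟩
    rw [h] at this
    obtain ⟨r, r', hr, hrr, he⟩ := this
    obtain ⟨he1, he2⟩ := Prod.ext_iff.1 he
    have e1 := hc r u hrr.left hbu (hr.trans hu.symm) (he1.trans h1)
    have e2 := hc r' u' hrr.right hbu' (by rw [hrr.length_eq, hr, hu']) (he2.trans h2)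
    exact e1 ▸ e2 ▸ hrr
  have hconn : ∀ {m m' : ℕ}, levelData A c w m = levelData A c w m' → ∀ {v u v' u'},
      v.length = m → A.IsBoundary v → A.IsBoundary v' → u.length = m' → A.IsBoundary u →
      u'.length = m' → A.IsBoundary u' →
      c v = c u → c v' = c u' → A.Conn False v v' → A.Conn False u u' := by
    intro m m' h v u v' u' hm hbv hbv' hu hbu hu' hbu' h1 h2 hvv
    have : (c v, c v') ∈ (levelData A c w m).2.1 := ⟨v, v', hm, hbv, hbv', hvv, rfl⟩
    rw [h] at this
    obtain ⟨r, r', hr, hbr, hbr', hrr, he⟩ := this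
    obtain ⟨he1, he2⟩ := Prod.ext_iff.1 he
    have e1 := hc r u hbr hbu (hr.trans hu.symm) (he1.trans h1)
    have e2 := hc r' u' hbr' hbu' (by rw [hrr.length_eq, hr, hu']) (he2.trans h2)
    exact e1 ▸ e2 ▸ hrr
  have hbase : ∀ {m m' : ℕ}, levelData A c w m = levelData A c w m' → ∀ {v u},
      A.IsBoundary v → u.length = m' → A.IsBoundary u →
      c v = c u → A.Conn False v (pref w m) → A.Conn False u (pref w m') := by
    intro m m' h v u hbv hu hbu h1 hv
    have : c v ∈ (levelData A c w m).2.2 := ⟨v, hbv, hv, rfl⟩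
    rw [h] at this
    obtain ⟨r, hbr, hr, he⟩ := this
    have hl := hr.length_eq
    rw [length_pref] at hl
    exact hc r u hbr hbu (hl.symm.trans hu.symm) (he.trans h1) ▸ hr
  have htotal : ∀ {m m' : ℕ}, levelData A c w m = levelData A c w m' → ∀ {v},
      v.length = m → A.IsBoundary v → ∃ u, u.length = m' ∧ A.IsBoundary u ∧ c v = c u := by
    intro m m' h v hm hv
    have : (c v, c v) ∈ (levelData A c w m).2.1 :=
      ⟨v, v, hm, hv, hv, Relation.ReflTransGen.refl, rfl⟩
    rw [h] at this
    obtain ⟨r, r', hr, hbr, -, -, he⟩ := this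
    exact ⟨r, hr, hbr, (Prod.ext_iff.1 he).1.symm⟩
  constructor
  · exact fun v u h => h.1
  · exact fun v u h => h.2.1
  · intro v hm hv
    obtain ⟨u, h1, h2, h3⟩ := htotal h hm hv
    exact ⟨u, ⟨hm, hv⟩, ⟨h1, h2⟩, h3⟩
  · intro v hm hv
    obtain ⟨u, h1, h2, h3⟩ := htotal h.symm hm hv
    exact ⟨u, ⟨h1, h2⟩, ⟨hm, hv⟩, h3.symm⟩
  · rintro t v u v' u' ⟨⟨a, b⟩, ⟨a', b'⟩, hh⟩ ⟨⟨p, q⟩, ⟨p', q'⟩, hh'⟩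
    exact ⟨hlink h a a' b' p' q' hh hh', hlink h.symm a' a b p q hh.symm hh'.symm⟩
  · rintro v u v' u' ⟨⟨a, b⟩, ⟨a', b'⟩, hh⟩ ⟨⟨p, q⟩, ⟨p', q'⟩, hh'⟩
    exact ⟨hconn h a b q a' b' p' q' hh hh', hconn h.symm a' b' q' a b p q hh.symm hh'.symm⟩
  · rintro v u ⟨⟨a, b⟩, ⟨a', b'⟩, hh⟩
    exact ⟨hbase h b a' b' hh, hbase h.symm b' a b hh.symm⟩

end Boundary

/-! ### Computable bounds and periodicity of branching -/

/-- The number of codes of boundary words, for `n` states and `k` letters. -/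
def codeBound (n k : ℕ) : ℕ := 2 * ((k + 1) ^ n * (k + 1) ^ 2 ^ n)

/-- The number of values of `levelData`, for `n` states and `c` codes of boundary words. -/
def dataBound (n c : ℕ) : ℕ := 2 ^ (n * (c * c)) * (2 ^ (c * c) * 2 ^ c)

theorem IsBounded.exists_levelIso {n k : ℕ} {A : MealyAutomaton (Fin n) (Fin k)}
    (hA : A.IsBounded) (w : ℕ → Fin k) (a p : ℕ) :
    ∃ i j φ, i < j ∧ j ≤ dataBound n (codeBound n k) ∧
      A.LevelIso w (a + p * i) (a + p * j) φ := by
  classical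
  have hc := fun v v' hv hv' hl h => hA.eq_of_boundaryCode_eq (v := v) (v' := v') hv hv' hl h
  -- Pigeonhole on levels in arithmetic progression, so that for period `p` the word continues
  -- identically after both.
  obtain ⟨i, j, hij, he⟩ := Fintype.exists_ne_map_eq_of_card_lt
    (fun i : Fin (dataBound n (codeBound n k) + 1) =>
      levelData A A.boundaryCode w (a + p * i)) (by
        rw [Fintype.card_fin]
        simp [dataBound, codeBound])
  rcases lt_or_gt_of_ne hij with hij | hij
  exacts [⟨i, j, _, hij, by omega, levelIso_of_levelData_eq hc he⟩,
    ⟨j, i, _, hij, by omega, levelIso_of_levelData_eq hc he.symm⟩]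

theorem IsBounded.branches_periodic {n k : ℕ} {A : MealyAutomaton (Fin n) (Fin k)}
    (hA : A.IsBounded) {w : ℕ → Fin k} {a p : ℕ} (hp : 0 < p)
    (hw : ∀ m, a ≤ m → w (m + p) = w m) :
    ∃ d, 0 < d ∧ d ≤ a + p * dataBound n (codeBound n k) ∧
      ∀ m, a + p * dataBound n (codeBound n k) ≤ m →
        (A.Branches w (m + d) ↔ A.Branches w m) := by
  obtain ⟨i, j, φ, hij, hj, h⟩ := hA.exists_levelIso w a p
  have hw' : ∀ m r, a ≤ m → w (m + p * r) = w m := by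
    intro m r hm
    induction r with
    | zero => rfl
    | succ r ih => rw [Nat.mul_succ, ← add_assoc, hw _ (by omega), ih]
  have hpj : p * j = p * i + p * (j - i) := by rw [← mul_add, Nat.add_sub_cancel' hij.le]
  have hpj' := Nat.mul_le_mul_left p hj
  refine ⟨p * (j - i), Nat.mul_pos hp (by omega), by omega, fun m hm => ?_⟩
  have := h.branches_add (fun l => by
    rw [show a + p * j + l = a + p * i + l + p * (j - i) by omega, hw' _ _ (by omega)])
    (m - (a + p * i))
  rw [show a + p * i + (m - (a + p * i)) = m by omega,
    show a + p * j + (m - (a + p * i)) = m + p * (j - i) by omega] at this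
  exact this.symm

/-- The period `d` need not be known: since `d ≤ M`, the window from `M` to `2 * M - 1` contains a
full period. -/
theorem exists_ge_iff_of_periodic {P : ℕ → Prop} {M d : ℕ} (hd : 0 < d) (hdM : d ≤ M)
    (h : ∀ m, M ≤ m → (P (m + d) ↔ P m)) :
    (∃ m₀, ∀ m, m₀ ≤ m → ¬ P m) ↔ ∀ m, M ≤ m → m < 2 * M → ¬ P m := by
  constructor
  · rintro ⟨m₀, h0⟩ m hm - hP
    have : ∀ r, P (m + d * r) := by
      intro r
      induction r with
      | zero => exact hP
      | succ r ih => rw [Nat.mul_succ, ← add_assoc, h _ (by omega)]; exact ih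
    exact h0 _ ((Nat.le_mul_of_pos_left m₀ hd).trans (Nat.le_add_left _ m)) (this m₀)
  · intro hM
    refine ⟨M, fun m => ?_⟩
    induction m using Nat.strong_induction_on with
    | _ m ih =>
      intro hm
      by_cases hm2 : m < 2 * M
      · exact hM m hm hm2
      · have h1 := h (m - d) (by omega)
        rw [show m - d + d = m by omega] at h1
        exact h1.not.2 (ih (m - d) (by omega) (by omega))

end MealyAutomaton

namespace MealyAutomaton

/-! ### Finite orbits and branching -/

section Orbit

variable {S X : Type*} {A : MealyAutomaton S X}

theorem pref_actSeq (s : S) (w : ℕ → X) (m : ℕ) :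
    pref (A.actSeq s w) m = A.act s (pref w m) ∧ A.run s w m = A.sec s (pref w m) := by
  induction m with
  | zero => exact ⟨rfl, rfl⟩
  | succ m ih =>
    rw [pref_succ, pref_succ, act_concat, sec_concat, run, ih.1, ih.2, actSeq, ih.2]
    exact ⟨rfl, rfl⟩

theorem take_pref (w : ℕ → X) {i m : ℕ} (h : i ≤ m) : (pref w m).take i = pref w i := by
  rw [pref, ← List.map_take, List.take_range, min_eq_left h, pref]

theorem take_act (s : S) (v : List X) (i : ℕ) : (A.act s v).take i = A.act s (v.take i) := by
  induction v generalizing s i with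
  | nil => simp [act]
  | cons x v ih => cases i <;> simp [act, ih]

theorem Conn.take {v z : List X} (h : A.Conn True v z) (i : ℕ) :
    A.Conn True (v.take i) (z.take i) := by
  have hl : ∀ {v z : List X}, A.Link True v z → A.Link True (v.take i) (z.take i) := by
    rintro v _ ⟨s, rfl, -⟩
    exact ⟨s, (take_act s v i).symm, Or.inl trivial⟩
  induction h with
  | refl => exact Relation.ReflTransGen.refl
  | tail _ h ih => exact ih.tail (h.imp hl hl)

theorem conn_pref_of_mem_group {g : Equiv.Perm (ℕ → X)} (hg : g ∈ A.group) (w : ℕ → X) (m : ℕ) :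
    A.Conn True (pref w m) (pref (g w) m) := by
  induction hg using Subgroup.closure_induction generalizing w with
  | mem g hg =>
    obtain ⟨s, hs⟩ := hg
    exact Link.conn ⟨s, by rw [hs, (pref_actSeq s w m).1], Or.inl trivial⟩
  | one => exact Relation.ReflTransGen.refl
  | mul g h _ _ ihg ihh => exact (ihh w).trans (ihg (h w))
  | inv g _ ih => simpa using (ih (g⁻¹ w)).symm

theorem pref_perm_eq_iff (hA : A.IsInvertible) {g : Equiv.Perm (ℕ → X)} (hg : g ∈ A.group)
    (w w' : ℕ → X) (m : ℕ) : pref (g w) m = pref (g w') m ↔ pref w m = pref w' m := by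
  induction hg using Subgroup.closure_induction generalizing w w' with
  | mem g hg =>
    obtain ⟨s, hs⟩ := hg
    rw [hs, (pref_actSeq s w m).1, (pref_actSeq s w' m).1, (hA s).1.eq_iff]
  | one => rfl
  | mul g h _ _ ihg ihh => exact (ihg (h w) (h w')).trans (ihh w w')
  | inv g _ ih => simpa using (ih (g⁻¹ w) (g⁻¹ w')).symm

/-- The equivalence, rather than one implication, lets arrows traversed backwards be realized by
inverses. -/
theorem IsInvertible.exists_mem_group_of_conn [Finite X] (hA : A.IsInvertible) {a b : List X}
    (h : A.Conn True a b) :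
    ∃ g ∈ A.group, ∀ (w : ℕ → X) (m : ℕ), pref w m = a ↔ pref (g w) m = b := by
  have hl : ∀ {a b}, A.Link True a b →
      ∃ g ∈ A.group, ∀ (w : ℕ → X) (m : ℕ), pref w m = a ↔ pref (g w) m = b := by
    rintro a _ ⟨s, rfl, -⟩
    obtain ⟨g, hg, hgs⟩ := hA.exists_perm s
    exact ⟨g, hg, fun w m => by rw [hgs, (pref_actSeq s w m).1, (hA s).1.eq_iff]⟩
  induction h with
  | refl => exact ⟨1, one_mem _, fun w m => Iff.rfl⟩
  | tail _ h ih =>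
    obtain ⟨g, hg, hgw⟩ := ih
    rcases h with h | h <;> obtain ⟨f, hf, hfw⟩ := hl h
    · exact ⟨f * g, mul_mem hf hg, fun w m => (hgw w m).trans (hfw (g w) m)⟩
    · refine ⟨f⁻¹ * g, mul_mem (inv_mem hf) hg, fun w m => (hgw w m).trans ?_⟩
      have := hfw (f⁻¹ (g w)) m
      simpa using this.symm

theorem exists_pref_bound {O : Set (ℕ → X)} (hO : O.Finite) (w : ℕ → X) :
    ∃ m, ∀ z ∈ O, pref z m = pref w m → z = w := by
  classical
  have hd : ∀ z : ℕ → X, ∃ i, z ≠ w → z i ≠ w i := fun z => by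
    by_cases h : z = w
    · exact ⟨0, fun h' => absurd h h'⟩
    · obtain ⟨i, hi⟩ := Function.ne_iff.1 h
      exact ⟨i, fun _ => hi⟩
  choose d hd using hd
  obtain ⟨m, hm⟩ := (hO.image d).bddAbove
  refine ⟨m + 1, fun z hz h => by_contra fun hne => hd z hne ?_⟩
  have hle : d z < m + 1 := Nat.lt_succ_iff.2 (hm ⟨z, hz, rfl⟩)
  exact List.map_inj_left.1 h _ (List.mem_range.2 hle)

/-- Points of a finite orbit other than `w` leave `w` before a fixed level, which excludes later
branching. Conversely, without branching from `m₀` on, a group element fixing the prefix of length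
`m₀` fixes `w`, so a point of the orbit is determined by its prefix of length `m₀`. -/
theorem IsInvertible.finite_orbit_iff [Finite X] (hA : A.IsInvertible) (w : ℕ → X) :
    (MulAction.orbit A.group w).Finite ↔ ∃ m₀, ∀ m, m₀ ≤ m → ¬ A.Branches w m := by
  constructor
  · intro hO
    obtain ⟨m₀, h0⟩ := exists_pref_bound hO w
    refine ⟨m₀, fun m hm ⟨x, hx, hc⟩ => ?_⟩
    obtain ⟨g, hg, hgw⟩ := hA.exists_mem_group_of_conn hc
    have h1 := (hgw w (m + 1)).1 rfl
    rw [pref_succ, List.append_singleton_inj] at h1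
    have h2 : g w = w := h0 (g w) ⟨⟨g, hg⟩, rfl⟩ (by
      rw [← take_pref _ hm, h1.1, take_pref _ hm])
    exact hx (by rw [← h1.2, h2])
  · rintro ⟨m₀, h0⟩
    have hfix : ∀ f ∈ A.group, pref (f w) m₀ = pref w m₀ → f w = w := by
      intro f hf hfw
      have key : ∀ i, pref (f w) (m₀ + i) = pref w (m₀ + i) := by
        intro i
        induction i with
        | zero => exact hfw
        | succ i ih =>
          rw [← add_assoc, pref_succ, pref_succ, ih]
          by_contra hne
          refine h0 (m₀ + i) (by omega) ⟨f w (m₀ + i), fun h => hne (by rw [h]), ?_⟩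
          have := conn_pref_of_mem_group hf w (m₀ + i + 1)
          rwa [pref_succ (f w), ih] at this
      funext i
      have := List.map_inj_left.1 (key (i + 1)) i (List.mem_range.2 (by omega))
      exact this
    have himage : ((fun z => pref z m₀) '' MulAction.orbit A.group w).Finite := by
      refine (List.finite_length_eq X m₀).subset ?_
      rintro _ ⟨z, -, rfl⟩
      exact length_pref z m₀
    refine Set.Finite.of_finite_image himage ?_
    · rintro _ ⟨⟨g, hg⟩, rfl⟩ _ ⟨⟨h, hh⟩, rfl⟩ hgh
      have h1 : pref ((g⁻¹ * h) w) m₀ = pref w m₀ := by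
        have := (pref_perm_eq_iff hA (inv_mem hg) (g w) (h w) m₀).2 hgh
        simpa using this.symm
      have h2 := hfix _ (mul_mem (inv_mem hg) hh) h1
      have h3 : h w = g w := by simpa using congrArg g h2
      exact h3.symm

/-- Turns branching at a range of levels into one condition on the orbit of a single finite word. -/
theorem IsInvertible.forall_not_branches_iff [Finite X] (hA : A.IsInvertible) (w : ℕ → X)
    (M N : ℕ) : (∀ m, M ≤ m → m < N → ¬ A.Branches w m) ↔
      ∀ z, A.Conn True (pref w N) z → z.take M = pref w M → z = pref w N := by
  constructor
  · intro h z hz hM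
    have hzl := hz.length_eq
    rw [length_pref] at hzl
    have key : ∀ i, M + i ≤ N → z.take (M + i) = pref w (M + i) := by
      intro i
      induction i with
      | zero => exact fun _ => hM
      | succ i ih =>
        intro hi
        have hlt : M + i < z.length := by omega
        rw [← add_assoc, List.take_succ_eq_append_getElem hlt, ih (by omega), pref_succ]
        by_contra hne
        refine h (M + i) (by omega) (by omega) ⟨z[M + i], fun h => hne (by rw [h]), ?_⟩
        have := hz.take (M + i + 1)
        rwa [take_pref w (by omega), List.take_succ_eq_append_getElem hlt, ih (by omega)] at this
    rcases le_total M N with hMN | hMN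
    · have := key (N - M) (by omega)
      rwa [Nat.add_sub_cancel' hMN, List.take_of_length_le hzl.le] at this
    · have := congrArg (List.take N) hM
      rwa [take_pref w hMN, List.take_take, min_eq_left hMN, List.take_of_length_le hzl.le] at this
  · rintro h m hM hN ⟨x, hx, hc⟩
    obtain ⟨g, hg, hgw⟩ := hA.exists_mem_group_of_conn hc
    have h1 := (hgw w (m + 1)).1 rfl
    rw [pref_succ, List.append_singleton_inj] at h1
    have hMN := hM.trans hN.le
    have h2 := h (pref (g w) N) (conn_pref_of_mem_group hg w N) (by
      rw [take_pref _ hMN, ← take_pref _ hM, h1.1, take_pref _ hM])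
    exact hx (by rw [← h1.2]; exact List.map_inj_left.1 h2 m (List.mem_range.2 hN))

end Orbit

/-! ### Orbits of finite words without inverses -/

section Reach

variable {S X : Type*} {A : MealyAutomaton S X}

/-- The set reached by forward steps is finite, and each state maps it injectively to itself, hence
onto. Backward steps therefore do not leave it. -/
theorem IsInvertible.conn_iff_reflTransGen [Finite X] (hA : A.IsInvertible) {v z : List X} :
    A.Conn True v z ↔ Relation.ReflTransGen (fun a b => ∃ s, A.act s a = b) v z := by
  refine ⟨fun h => ?_, fun h => ?_⟩
  rotate_left
  · induction h with
    | refl => exact Relation.ReflTransGen.refl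
    | tail _ h ih =>
      obtain ⟨s, hs⟩ := h
      exact ih.tail (Or.inl ⟨s, hs, Or.inl trivial⟩)
  induction h with
  | refl => exact Relation.ReflTransGen.refl
  | @tail b c _ h ih =>
    rcases h with ⟨s, hs, -⟩ | ⟨s, hs, -⟩
    · exact ih.tail ⟨s, hs⟩
    · let R := {a | Relation.ReflTransGen (fun a b => ∃ s, A.act s a = b) v a}
      have hl : ∀ a ∈ R, a.length = v.length := fun a ha => by
        induction ha with
        | refl => rfl
        | tail _ h ih => obtain ⟨s, rfl⟩ := h; rw [length_act, ih]
      have hR : R.Finite := (List.finite_length_eq X v.length).subset hl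
      have hmaps : Set.MapsTo (A.act s) R R := fun a ha => ha.tail ⟨s, rfl⟩
      obtain ⟨c', hc', hb⟩ :=
        ((hR.injOn_iff_bijOn_of_mapsTo hmaps).1 (hA s).1.injOn).surjOn ih
      rwa [(hA s).1 (hb.trans hs.symm)] at hc'

end Reach

end MealyAutomaton

/-! ### Enumeration of an orbit by iteration -/

/-- The words obtained from those in `L` by at most `i` transformations from `fs`. -/
def closureIter {σ α : Type*} (f : σ → α → α) (fs : List σ) (L : List α) (i : ℕ) : List α :=
  (fun L => L ++ fs.flatMap fun s => L.map (f s))^[i] L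

theorem mem_closureIter_succ {σ α : Type*} {f : σ → α → α} {fs : List σ} {L : List α} {i : ℕ}
    {b : α} : b ∈ closureIter f fs L (i + 1) ↔
      b ∈ closureIter f fs L i ∨ ∃ s ∈ fs, ∃ a ∈ closureIter f fs L i, f s a = b := by
  simp [closureIter, Function.iterate_succ_apply']

theorem mem_closureIter_iff {σ α : Type*} {f : σ → α → α} {fs : List σ} {v z : α} {N : ℕ}
    {B : Finset α} (hv : v ∈ B) (hB : ∀ s ∈ fs, ∀ a ∈ B, f s a ∈ B) (hN : B.card ≤ N) :
    z ∈ closureIter f fs [v] N ↔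
      Relation.ReflTransGen (fun a b => ∃ s ∈ fs, f s a = b) v z := by
  classical
  let F : ℕ → Finset α := fun i => (closureIter f fs [v] i).toFinset
  have hF : ∀ i b, b ∈ F (i + 1) ↔ b ∈ F i ∨ ∃ s ∈ fs, ∃ a ∈ F i, f s a = b := by
    intro i b
    simp only [F, List.mem_toFinset, mem_closureIter_succ]
  have hv0 : ∀ i, v ∈ F i := by
    intro i
    induction i with
    | zero => simp [F, closureIter]
    | succ i ih => exact (hF i v).2 (Or.inl ih)
  have hsub : ∀ i, F i ⊆ B := by
    intro i
    induction i with
    | zero => simpa [F, closureIter] using hv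
    | succ i ih =>
      intro b hb
      rcases (hF i b).1 hb with hb | ⟨s, hs, a, ha, rfl⟩
      exacts [ih hb, hB s hs a (ih ha)]
  -- Until the sets become closed, each step adds an element; this cannot go on for more steps than
  -- `B` has elements.
  have hstep : ∀ i, (∀ s ∈ fs, ∀ a ∈ F i, f s a ∈ F i) ∨ i < (F i).card := by
    intro i
    induction i with
    | zero => exact Or.inr (Finset.card_pos.2 ⟨v, hv0 0⟩)
    | succ i ih =>
      by_cases hc : ∀ s ∈ fs, ∀ a ∈ F i, f s a ∈ F i
      · left
        have heq : F (i + 1) = F i := by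
          ext b
          refine ⟨fun hb => ?_, fun hb => (hF i b).2 (Or.inl hb)⟩
          rcases (hF i b).1 hb with hb | ⟨s, hs, a, ha, rfl⟩
          exacts [hb, hc s hs a ha]
        rwa [heq]
      · right
        have h1 := ih.resolve_left hc
        push Not at hc
        obtain ⟨s, hs, a, ha, hn⟩ := hc
        have : F i ⊂ F (i + 1) := Finset.ssubset_iff_subset_ne.2
          ⟨fun b hb => (hF i b).2 (Or.inl hb), fun he => hn (he ▸ (hF i _).2
            (Or.inr ⟨s, hs, a, ha, rfl⟩))⟩
        have := Finset.card_lt_card this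
        omega
  have hclosed := (hstep N).resolve_right
    (by have := Finset.card_le_card (hsub N); omega)
  have hmem : ∀ b i, b ∈ closureIter f fs [v] i ↔ b ∈ F i := fun b i => by simp [F]
  rw [hmem]
  constructor
  · have : ∀ i, ∀ b ∈ F i, Relation.ReflTransGen (fun a b => ∃ s ∈ fs, f s a = b) v b := by
      intro i
      induction i with
      | zero =>
        intro b hb
        rw [show b = v by simpa [F, closureIter] using hb]
      | succ i ih =>
        intro b hb
        rcases (hF i b).1 hb with hb | ⟨s, hs, a, ha, rfl⟩
        exacts [ih b hb, (ih a ha).tail ⟨s, hs, rfl⟩]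
    exact this N z
  · intro h
    induction h with
    | refl => exact hv0 N
    | tail _ h ih =>
      obtain ⟨s, hs, rfl⟩ := h
      exact hclosed s hs _ ih

/-! ### The test and its primitive recursiveness -/

section Computation

/-- The entry of a transition-output table. -/
def tableStep (T : List (List (ℕ × ℕ))) (s x : ℕ) : ℕ × ℕ := (T.getD s []).getD x (0, 0)

/-- The transformation of words defined by the state `s` of the automaton with table `T`. -/
def tableAct (T : List (List (ℕ × ℕ))) (s : ℕ) (v : List ℕ) : List ℕ :=
  (v.foldl (fun (p : ℕ × List ℕ) x => ((tableStep T p.1 x).2, p.2 ++ [(tableStep T p.1 x).1]))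
    (s, [])).2

/-- The prefix of length `m` of the word `u v v v …`. -/
def periodicPrefix (u v : List ℕ) (m : ℕ) : List ℕ :=
  (List.range m).map fun i =>
    if i < u.length then u.getD i 0 else v.getD ((i - u.length) % v.length) 0

/-- The length of the prefix after which branching of the orbit is tested. -/
def testLength (n k : ℕ) (u v : List ℕ) : ℕ :=
  u.length + v.length * MealyAutomaton.dataBound n (MealyAutomaton.codeBound n k)

/-- No two words in the orbit of a long prefix of `u v v v …` differ only at late letters. -/
def OrbitTest (a : (ℕ × ℕ × List (List (ℕ × ℕ))) × List ℕ × List ℕ) : Prop :=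
  ∀ z ∈ closureIter (tableAct a.1.2.2) (List.range a.1.1)
      [periodicPrefix a.2.1 a.2.2 (2 * testLength a.1.1 a.1.2.1 a.2.1 a.2.2)]
      (a.1.2.1 ^ (2 * testLength a.1.1 a.1.2.1 a.2.1 a.2.2)),
    ¬ z.take (testLength a.1.1 a.1.2.1 a.2.1 a.2.2) =
        periodicPrefix a.2.1 a.2.2 (testLength a.1.1 a.1.2.1 a.2.1 a.2.2) ∨
      z = periodicPrefix a.2.1 a.2.2 (2 * testLength a.1.1 a.1.2.1 a.2.1 a.2.2)

open Primrec

variable {α : Type*} [Primcodable α]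

theorem Primrec.nat_pow : Primrec₂ ((· ^ ·) : ℕ → ℕ → ℕ) :=
  Primrec₂.unpaired'.1 Nat.Primrec.pow

theorem Primrec.tableStep {T : α → List (List (ℕ × ℕ))} {s x : α → ℕ} (hT : Primrec T)
    (hs : Primrec s) (hx : Primrec x) : Primrec fun a => tableStep (T a) (s a) (x a) :=
  (list_getD (0, 0)).comp ((list_getD []).comp hT hs) hx

theorem Primrec.tableAct {T : α → List (List (ℕ × ℕ))} {s : α → ℕ} {v : α → List ℕ}
    (hT : Primrec T) (hs : Primrec s) (hv : Primrec v) :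
    Primrec fun a => tableAct (T a) (s a) (v a) := by
  have hstep : Primrec fun p : α × (ℕ × List ℕ) × ℕ => _root_.tableStep (T p.1) p.2.1.1 p.2.2 :=
    Primrec.tableStep (hT.comp fst) (fst.comp (fst.comp snd)) (snd.comp snd)
  exact snd.comp (list_foldl hv (hs.pair (.const []))
    (((snd.comp hstep).pair
      (list_concat.comp (snd.comp (fst.comp snd)) (fst.comp hstep))).to₂))

theorem Primrec.periodicPrefix {u v : α → List ℕ} {m : α → ℕ} (hu : Primrec u) (hv : Primrec v)
    (hm : Primrec m) : Primrec fun a => periodicPrefix (u a) (v a) (m a) := by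
  refine list_map (list_range.comp hm) ?_
  unfold Primrec₂
  have hul : Primrec fun p : α × ℕ => (u p.1).length := list_length.comp (hu.comp fst)
  exact Primrec.ite (nat_lt.comp snd hul)
    ((list_getD 0).comp (hu.comp fst) snd)
    ((list_getD 0).comp (hv.comp fst)
      (nat_mod.comp (nat_sub.comp snd hul) (list_length.comp (hv.comp fst))))

theorem Primrec.testLength {n k : α → ℕ} {u v : α → List ℕ} (hn : Primrec n) (hk : Primrec k)
    (hu : Primrec u) (hv : Primrec v) :
    Primrec fun a => testLength (n a) (k a) (u a) (v a) := by
  have two : Primrec fun _ : α => 2 := .const 2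
  have hk1 : Primrec fun a => k a + 1 := succ.comp hk
  have hc : Primrec fun a => MealyAutomaton.codeBound (n a) (k a) :=
    nat_mul.comp two (nat_mul.comp (nat_pow.comp hk1 hn) (nat_pow.comp hk1 (nat_pow.comp two hn)))
  have hcc := nat_mul.comp hc hc
  have hd : Primrec fun a =>
      MealyAutomaton.dataBound (n a) (MealyAutomaton.codeBound (n a) (k a)) :=
    nat_mul.comp (nat_pow.comp two (nat_mul.comp hn hcc))
      (nat_mul.comp (nat_pow.comp two hcc) (nat_pow.comp two hc))
  exact nat_add.comp (list_length.comp hu) (nat_mul.comp (list_length.comp hv) hd)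

theorem Primrec.closureIter {T : α → List (List (ℕ × ℕ))} {fs : α → List ℕ}
    {L : α → List (List ℕ)} {i : α → ℕ} (hT : Primrec T) (hfs : Primrec fs) (hL : Primrec L)
    (hi : Primrec i) :
    Primrec fun a => closureIter (_root_.tableAct (T a)) (fs a) (L a) (i a) := by
  refine nat_iterate hi hL ?_
  unfold Primrec₂
  refine list_append.comp snd (list_flatMap (hfs.comp fst) ?_)
  unfold Primrec₂
  refine list_map (snd.comp fst) ?_
  unfold Primrec₂
  exact Primrec.tableAct (hT.comp (fst.comp (fst.comp fst))) (snd.comp fst) snd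

/-- Every bound is an explicit primitive recursive function of the input, and the only quantifier
ranges over a computed list. -/
theorem primrecPred_orbitTest : PrimrecPred OrbitTest := by
  have hn : Primrec fun a : (ℕ × ℕ × List (List (ℕ × ℕ))) × List ℕ × List ℕ => a.1.1 :=
    fst.comp fst
  have hk : Primrec fun a : (ℕ × ℕ × List (List (ℕ × ℕ))) × List ℕ × List ℕ => a.1.2.1 :=
    fst.comp (snd.comp fst)
  have hT : Primrec fun a : (ℕ × ℕ × List (List (ℕ × ℕ))) × List ℕ × List ℕ => a.1.2.2 :=
    snd.comp (snd.comp fst)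
  have hu : Primrec fun a : (ℕ × ℕ × List (List (ℕ × ℕ))) × List ℕ × List ℕ => a.2.1 :=
    fst.comp snd
  have hv : Primrec fun a : (ℕ × ℕ × List (List (ℕ × ℕ))) × List ℕ × List ℕ => a.2.2 :=
    snd.comp snd
  have hM := Primrec.testLength hn hk hu hv
  have hN := nat_mul.comp (.const 2) hM
  have hwM := Primrec.periodicPrefix hu hv hM
  have hwN := Primrec.periodicPrefix hu hv hN
  have hL := Primrec.closureIter hT (list_range.comp hn) (list_cons.comp hwN (.const []))
    (nat_pow.comp hk hN)
  have hR : PrimrecRel fun (z : List ℕ)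
      (a : (ℕ × ℕ × List (List (ℕ × ℕ))) × List ℕ × List ℕ) =>
      ¬ z.take (_root_.testLength a.1.1 a.1.2.1 a.2.1 a.2.2) =
        _root_.periodicPrefix a.2.1 a.2.2 (_root_.testLength a.1.1 a.1.2.1 a.2.1 a.2.2) ∨
      z = _root_.periodicPrefix a.2.1 a.2.2
        (2 * _root_.testLength a.1.1 a.1.2.1 a.2.1 a.2.2) :=
    PrimrecPred.or
      (PrimrecPred.not (Primrec.eq.comp (list_take.comp (hM.comp snd) fst) (hwM.comp snd)))
      (Primrec.eq.comp fst (hwN.comp snd))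
  exact hR.forall_mem_list.comp hL Primrec.id

end Computation

/-! ### Correctness of the test -/

namespace MealyAutomaton

variable {n k : ℕ} (A : MealyAutomaton (Fin n) (Fin k))

theorem tableStep_code (s : Fin n) (x : Fin k) :
    tableStep A.code.2.2 s x = (((A.step s x).1 : ℕ), ((A.step s x).2 : ℕ)) := by
  simp [tableStep, code, List.getD_eq_getElem?_getD]

theorem tableAct_code (s : Fin n) (v : List (Fin k)) :
    tableAct A.code.2.2 s (v.map Fin.val) = (A.act s v).map Fin.val := by
  have key : ∀ (acc : List ℕ), ((v.map Fin.val).foldl (fun (p : ℕ × List ℕ) x =>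
      ((tableStep A.code.2.2 p.1 x).2, p.2 ++ [(tableStep A.code.2.2 p.1 x).1]))
      ((s : ℕ), acc)).2 = acc ++ (A.act s v).map Fin.val := by
    induction v generalizing s with
    | nil => simp [act]
    | cons x v ih => intro acc; simp [act, tableStep_code, ih]
  exact key []

theorem periodicPrefix_eq (u v : List (Fin k)) (hv : v ≠ []) (m : ℕ) :
    periodicPrefix (u.map Fin.val) (v.map Fin.val) m =
      (pref (eventuallyPeriodicWord u v hv) m).map Fin.val := by
  rw [periodicPrefix, pref, List.map_map]
  refine List.map_congr_left fun i _ => ?_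
  have hm : (i - u.length) % v.length < v.length := Nat.mod_lt _ (List.length_pos_iff.2 hv)
  by_cases h : i < u.length
  · simp [eventuallyPeriodicWord, h]
  · simp [eventuallyPeriodicWord, h, hm]

theorem eventuallyPeriodicWord_add_length {X : Type*} (u v : List X) (hv : v ≠ []) {m : ℕ}
    (hm : u.length ≤ m) :
    eventuallyPeriodicWord u v hv (m + v.length) = eventuallyPeriodicWord u v hv m := by
  have h1 : ¬ m < u.length := by omega
  have h2 : ¬ m + v.length < u.length := by omega
  have h3 : (m + v.length - u.length) % v.length = (m - u.length) % v.length := by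
    rw [show m + v.length - u.length = m - u.length + v.length by omega, Nat.add_mod_right]
  simp [eventuallyPeriodicWord, h1, h2, h3]

variable {A}

theorem IsInvertible.mem_closureIter_iff (hA : A.IsInvertible) (v : List (Fin k)) (l : List ℕ) :
    l ∈ closureIter (tableAct A.code.2.2) (List.range n) [v.map Fin.val] (k ^ v.length) ↔
      ∃ z, A.Conn True v z ∧ z.map Fin.val = l := by
  classical
  -- All words of the length of `v`, as lists of numbers: at most `k ^ v.length` of them, hence the
  -- number of iterations.
  let B : Finset (List ℕ) := Finset.univ.image fun f : Fin v.length → Fin k =>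
    (List.ofFn f).map Fin.val
  have hB : ∀ z : List (Fin k), z.length = v.length → z.map Fin.val ∈ B := fun z hz =>
    Finset.mem_image.2 ⟨fun i => z[(i : ℕ)], Finset.mem_univ _,
      congrArg _ (List.ext_getElem (by simp [hz]) fun i h1 h2 => by simp)⟩
  rw [_root_.mem_closureIter_iff (hB v rfl) (fun s hs a ha => ?_)
    (Finset.card_image_le.trans (by simp))]
  · constructor
    · intro h
      induction h with
      | refl => exact ⟨v, Relation.ReflTransGen.refl, rfl⟩
      | tail _ h ih =>
        obtain ⟨s, hs, rfl⟩ := h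
        obtain ⟨z, hz, rfl⟩ := ih
        exact ⟨_, hz.trans (Link.conn ⟨⟨s, List.mem_range.1 hs⟩, rfl, Or.inl trivial⟩),
          (A.tableAct_code ⟨s, _⟩ z).symm⟩
    · rintro ⟨z, hz, rfl⟩
      rw [hA.conn_iff_reflTransGen] at hz
      induction hz with
      | refl => exact Relation.ReflTransGen.refl
      | tail _ h ih =>
        obtain ⟨s, rfl⟩ := h
        exact ih.tail ⟨s, List.mem_range.2 s.2, A.tableAct_code s _⟩
  · obtain ⟨f, -, rfl⟩ := Finset.mem_image.1 ha
    rw [A.tableAct_code ⟨s, List.mem_range.1 hs⟩]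
    exact hB _ (by simp [length_act])

theorem IsBounded.orbitTest_iff (hA : A.IsBounded) (u v : List (Fin k)) (hv : v ≠ []) :
    OrbitTest (A.code, u.map Fin.val, v.map Fin.val) ↔
      (MulAction.orbit A.group (eventuallyPeriodicWord u v hv)).Finite := by
  -- The preperiod `u.length` and the period `v.length` of the word give exactly the bound used as
  -- `testLength`.
  obtain ⟨d, hd, hdM, hper⟩ := hA.branches_periodic (List.length_pos_iff.2 hv)
    fun m hm => eventuallyPeriodicWord_add_length u v hv hm
  rw [hA.1.finite_orbit_iff, exists_ge_iff_of_periodic hd hdM hper,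
    hA.1.forall_not_branches_iff]
  have hinj : Function.Injective (List.map (Fin.val : Fin k → ℕ)) :=
    List.map_injective_iff.2 Fin.val_injective
  have hM : testLength n k (u.map Fin.val) (v.map Fin.val) =
      u.length + v.length * dataBound n (codeBound n k) := by simp [testLength]
  generalize u.length + v.length * dataBound n (codeBound n k) = M at hM ⊢
  have hL := hA.1.mem_closureIter_iff (pref (eventuallyPeriodicWord u v hv) (2 * M))
  rw [length_pref] at hL
  change (∀ z ∈ closureIter (tableAct A.code.2.2) (List.range n)
    [periodicPrefix _ _ (2 * testLength n k _ _)] (k ^ (2 * testLength n k _ _)), _) ↔ _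
  simp only [code] at hL ⊢
  simp only [hM, periodicPrefix_eq u v hv, hL]
  constructor
  · intro h z hz hzM
    rcases h _ ⟨z, hz, rfl⟩ with h | h
    · exact absurd (by rw [← List.map_take, hzM]) h
    · exact hinj h
  · rintro h _ ⟨z, hz, rfl⟩
    rw [← List.map_take, hinj.eq_iff, hinj.eq_iff, or_iff_not_imp_left, not_not]
    exact h z hz

end MealyAutomaton

theorem mainTheorem7 :
    ∃ decideFinite : (ℕ × ℕ × List (List (ℕ × ℕ))) × List ℕ × List ℕ → Bool,
      Computable decideFinite ∧
        ∀ (n k : ℕ), 2 ≤ k →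
          ∀ A : MealyAutomaton (Fin n) (Fin k), A.IsBounded →
            ∀ (u v : List (Fin k)) (hv : v ≠ []),
              (decideFinite (A.code, u.map Fin.val, v.map Fin.val) = true ↔
                (MulAction.orbit A.group (eventuallyPeriodicWord u v hv)).Finite) := by
  -- The anonymous component is the decidability instance for which `decide` is primitive recursive.
  obtain ⟨_, h⟩ := primrecPred_orbitTest
  refine ⟨fun a => decide (OrbitTest a), h.to_comp, fun n k _ A hA u v hv => ?_⟩
  rw [decide_eq_true_iff]
  exact hA.orbitTest_iff u v hv
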